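/- Conventions. Let $\mathbf{C}$ be an essentially small category with pushouts. A compact ordered space is a compact topological space with a partial order that is closed in the square; $\mathbf{KOrd}$ is the category of compact ordered spaces and continuous order-preserving maps. A lax square of posets consisting of $f\colon A\to B$, $g\colon A\to C$, $u\colon B\to D$, $v\colon C\to D$ with $u\circ f\le v\circ g$ has the interpolation property if whenever $u(b)\le v(c)$, there is $a\in A$ with $b\le f(a)$ and $g(a)\le c$. A polyadic compact ordered space (over $\mathbf{C}$) is a functor $\mathcal{S}\colon \mathbf{C}^{\mathrm{op}}\to\mathbf{KOrd}$ that sends pushout squares to squares with interpolation and such that for each $\sigma\colon n\to m$ in $\mathbf{C}$, $\mathcal{S}(\sigma)$ is bounded (the direct image of an up-set is an up-set). It is open if moreover, for each $\sigma$, the direct image under $\mathcal{S}(\sigma)$ of every open up-set is an open up-set. A morphism $f\colon\mathcal{S}\to\mathcal{P}$ is a natural transformation whose naturality squares have the interpolation property: for $\sigma\colon n\to m$, if $t\in\mathcal{P}(m)$, $s\in\mathcal{S}(n)$ and $\mathcal{P}(\sigma)(t)\le f_n(s)$, then there is $a\in\mathcal{S}(m)$ with $t\le f_m(a)$ and $\mathcal{S}(\sigma)(a)\le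 s$. A type of $\mathcal{S}$ is an ind-object $X$ of $\mathbf{C}$ (seen as a presheaf $\mathbf{C}^{\mathrm{op}}\to\mathbf{Set}$) with a natural transformation $x\colon X\to\mathcal{S}$. A morphism from $x\colon X\to\mathcal{S}$ to $y\colon Y\to\mathcal{S}$ is a morphism $h\colon X\to Y$ of ind-objects with $x\le y\circ h$ pointwise. A type is an $\omega$-saturated model if its naturality squares, in the same direction as above and with the sets $X(n)$ discretely ordered, have the interpolation property; $\mathrm{Mod}_\omega(\mathcal{S})$ is the full subcategory of types on the $\omega$-saturated models. If $\mathcal{S}$ is open, a model of $\mathcal{S}$ is an ind-object $X$ with a natural transformation $\beta\circ X\to\mathcal{S}$ whose naturality squares have the interpolation property, where $\beta$ is the Stone–Čech compactification of sets, with discrete order; by restriction to $X$ (which determines it) it is identified with a type, and $\mathrm{Mod}(\mathcal{S})$ is the full subcategory of types on the models. Composition with a morphism $f\colon\mathcal{S}\to\mathcal{P}$ induces a functor $f^*\colon\mathrm{Mod}_\omega(\mathcal{S})\to\mathrm{Mod}_\omega(\mathcal{P})$ and, if $\mathcal{S}$ and $\mathcal{P}$ are open, a functor $f^*\colon\mathrm{Mod}(\mathcal{S})\to\mathrm{Mod}(\mathcal{P})$.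 Proposition. Let $f\colon\mathcal{S}\to\mathcal{P}$ be a morphism of polyadic compact ordered spaces over $\mathbf{C}$, and let $f^*$ be either the induced functor $\mathrm{Mod}_\omega(\mathcal{S})\to\mathrm{Mod}_\omega(\mathcal{P})$ or, when $\mathcal{S}$ and $\mathcal{P}$ are open, the induced functor $\mathrm{Mod}(\mathcal{S})\to\mathrm{Mod}(\mathcal{P})$. Then: 1. $f^*$ is faithful. 2. If $f^*$ is essentially surjective, then $f$ is pointwise surjective, i.e. every $f_n$ is surjective. 3. If $f^*$ is fully faithful, then $f$ is a pointwise embedding, i.e. every $f_n$ is a topological embedding with $f_n(x)\le f_n(y)\iff x\le y$. 4. If $f^*$ is an equivalence, then $f$ is an isomorphism of polyadic compact ordered spaces. -/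

import Mathlib

open CategoryTheory Opposite

universe v u

namespace Polyadic

/-! ### Compact ordered spaces -/

/-- The category of compact ordered spaces: compact topological spaces with a partial order that
is a closed subset of the square; the morphisms are the continuous order-preserving functions. -/
structure KOrd where
  of ::
  carrier : Type v
  [top : TopologicalSpace carrier]
  [ord : PartialOrder carrier]
  [compact : CompactSpace carrier]
  [closed : OrderClosedTopology carrier]

namespace KOrd

attribute [instance] KOrd.top KOrd.ord KOrd.compact KOrd.closed

instance : CoeSort KOrd.{v} (Type v) := ⟨KOrd.carrier⟩

@[ext]
structure Hom (X Y : KOrd.{v}) where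
  hom' : X →Co Y

instance : Category KOrd.{v} where
  Hom X Y := Hom X Y
  id X := ⟨ContinuousOrderHom.id X⟩
  comp f g := ⟨g.hom'.comp f.hom'⟩

instance : ConcreteCategory KOrd.{v} (fun X Y => X →Co Y) where
  hom := Hom.hom'
  ofHom := Hom.mk

end KOrd

/-! ### Order-theoretic notions -/

/-- The interpolation property of the lax square `u ∘ f ≤ v ∘ g`, with `f : A → B` on the left,
`g : A → C` on top, `u : B → D` at the bottom and `v : C → D` on the right. -/
def HasInterpolation {A B C D : Type*} [LE B] [LE C] [LE D]
    (f : A → B) (g : A → C) (u : B → D) (v : C → D) : Prop :=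
  ∀ (b : B) (c : C), u b ≤ v c → ∃ a : A, b ≤ f a ∧ g a ≤ c

/-- A map is bounded if the direct image of every up-set is an up-set. -/
def IsBoundedMap {A B : Type*} [LE A] [LE B] (f : A → B) : Prop :=
  ∀ U : Set A, IsUpperSet U → IsUpperSet (f '' U)

/-- A map is lower semi-open if the direct image of every open up-set is an open up-set. -/
def IsLowerSemiOpen {A B : Type*} [TopologicalSpace A] [LE A] [TopologicalSpace B] [LE B]
    (f : A → B) : Prop :=
  ∀ U : Set A, IsOpen U → IsUpperSet U → IsOpen (f '' U) ∧ IsUpperSet (f '' U)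

/-! ### Polyadic compact ordered spaces -/

variable {C : Type u} [Category.{v} C]

/-- The naturality squares of `φ` have the interpolation property: if `S(σ)` denotes the action of
`σ : n ⟶ m`, and `T(σ) t ≤ φₙ s` with `t ∈ T(m)` and `s ∈ S(n)`, then there is `a ∈ S(m)` with
`t ≤ φₘ a` and `S(σ) a ≤ s`. -/
def NatInterpolation {S T : Cᵒᵖ ⥤ KOrd.{v}} (φ : S ⟶ T) : Prop :=
  ∀ ⦃n m : C⦄ (σ : n ⟶ m),
    HasInterpolation (φ.app (op m)) (S.map σ.op) (T.map σ.op) (φ.app (op n))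

variable (C) in
/-- Polyadic compact ordered spaces over `C`. -/
structure PolyadicSpace where
  /-- the underlying presheaf -/
  functor : Cᵒᵖ ⥤ KOrd.{v}
  /-- pushout squares are sent to squares with interpolation -/
  interpolation : ∀ ⦃a b c d : C⦄ (f : a ⟶ b) (g : a ⟶ c) (i : b ⟶ d) (j : c ⟶ d),
    IsPushout f g i j →
      HasInterpolation (functor.map i.op) (functor.map j.op) (functor.map f.op) (functor.map g.op)
  /-- every morphism is sent to a bounded map -/
  bounded : ∀ ⦃n m : C⦄ (σ : n ⟶ m), IsBoundedMap (functor.map σ.op)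

namespace PolyadicSpace

/-- A polyadic compact ordered space is open if all its transition maps are lower semi-open. -/
def IsOpenSpace (S : PolyadicSpace C) : Prop :=
  ∀ ⦃n m : C⦄ (σ : n ⟶ m), IsLowerSemiOpen (S.functor.map σ.op)

/-- Morphisms of polyadic compact ordered spaces: natural transformations whose naturality
squares have the interpolation property. -/
@[ext]
structure Hom (S P : PolyadicSpace C) where
  nat : S.functor ⟶ P.functor
  interpolation : NatInterpolation nat

theorem natInterpolation_id (S : Cᵒᵖ ⥤ KOrd.{v}) : NatInterpolation (𝟙 S) :=
  fun _ _ _ t _ h => ⟨t, le_refl _, h⟩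

theorem natInterpolation_comp {S T P : Cᵒᵖ ⥤ KOrd.{v}} {φ : S ⟶ T} {ψ : T ⟶ P}
    (hφ : NatInterpolation φ) (hψ : NatInterpolation ψ) : NatInterpolation (φ ≫ ψ) := by
  intro n m σ p s h
  obtain ⟨t, ht, ht'⟩ := hψ σ p (φ.app (op n) s) h
  obtain ⟨a, ha, ha'⟩ := hφ σ t s ht'
  exact ⟨a, ht.trans ((ψ.app (op m)).hom'.monotone' ha), ha'⟩

instance : Category (PolyadicSpace C) where
  Hom S P := Hom S P
  id S := ⟨𝟙 _, natInterpolation_id _⟩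
  comp f g := ⟨f.nat ≫ g.nat, natInterpolation_comp f.interpolation g.interpolation⟩

end PolyadicSpace

/-! ### Types -/

/-- A type of `S`: an ind-object `X` of `C`, seen as a presheaf, with a natural transformation
from `X` to `S`. -/
structure SType (S : PolyadicSpace C) where
  ind : Cᵒᵖ ⥤ Type v
  isInd : Limits.IsIndObject ind
  val : ind ⟶ S.functor ⋙ forget KOrd.{v}

namespace SType

variable {S P : PolyadicSpace C}

/-- The element of `S(n)` associated to an `n`-point of the ind-object. -/
def eval (X : SType S) (n : Cᵒᵖ) (p : X.ind.obj n) : S.functor.obj n := X.val.app n p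

/-- A morphism of types from `x : X → S` to `y : Y → S` is a morphism `h : X ⟶ Y` of ind-objects
such that `x ≤ y ∘ h`. -/
@[ext]
structure Hom (X Y : SType S) where
  map : X.ind ⟶ Y.ind
  eval_le : ∀ (n : Cᵒᵖ) (p : X.ind.obj n), X.eval n p ≤ Y.eval n (map.app n p)

/-- The category of types of `S`. -/
instance : Category (SType S) where
  Hom X Y := Hom X Y
  id X := ⟨𝟙 _, fun _ _ => le_refl _⟩
  comp f g := ⟨f.map ≫ g.map, fun n p => (f.eval_le n p).trans (g.eval_le n (f.map.app n p))⟩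

/-- The functor between categories of types given by composition with a morphism `S ⟶ P`. -/
def push (f : S ⟶ P) : SType S ⥤ SType P where
  obj X := ⟨X.ind, X.isInd, X.val ≫ Functor.whiskerRight f.nat (forget KOrd.{v})⟩
  map {X Y} h := ⟨h.map, fun n p => (f.nat.app n).hom'.monotone' (h.eval_le n p)⟩

end SType

/-! ### `ω`-saturated models -/

/-- A type `τ : X → S` is an `ω`-saturated model if its naturality squares have the interpolation
property, where the sets `X(n)` carry the discrete order (so that an inequality in `X(n)` is
an equality). -/
def omegaSaturated (S : PolyadicSpace C) : ObjectProperty (SType S) := fun X =>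
  ∀ ⦃n m : C⦄ (σ : n ⟶ m) (s : S.functor.obj (op m)) (p : X.ind.obj (op n)),
    S.functor.map σ.op s ≤ X.eval (op n) p →
      ∃ q : X.ind.obj (op m), s ≤ X.eval (op m) q ∧ X.ind.map σ.op q = p

/-- The category of `ω`-saturated models, a full subcategory of the category of types. -/
abbrev ModOmega (S : PolyadicSpace C) := (omegaSaturated S).FullSubcategory

theorem omegaSaturated_push {S P : PolyadicSpace C} (f : S ⟶ P) (X : SType S)
    (hX : omegaSaturated S X) : omegaSaturated P ((SType.push f).obj X) := by
  intro n m σ s p h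
  obtain ⟨a, ha, ha'⟩ := f.interpolation σ s (X.eval (op n) p) h
  obtain ⟨q, hq, hq'⟩ := hX σ a p ha'
  exact ⟨q, ha.trans ((f.nat.app (op m)).hom'.monotone' hq), hq'⟩

/-- The functor between the categories of `ω`-saturated models induced by a morphism `S ⟶ P`. -/
def modOmegaMap {S P : PolyadicSpace C} (f : S ⟶ P) : ModOmega S ⥤ ModOmega P :=
  (omegaSaturated P).lift ((omegaSaturated S).ι ⋙ SType.push f)
    (fun X => omegaSaturated_push f X.obj X.property)

/-! ### Models -/

/-- The discrete order on the space of ultrafilters. -/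
abbrev ultrafilterOrder (X : Type v) : PartialOrder (Ultrafilter X) where
  le a b := a = b
  le_refl _ := rfl
  le_trans _ _ _ := Eq.trans
  le_antisymm _ _ h _ := h

/-- The Stone-Čech compactification of a discrete set `X` (the space of ultrafilters on `X`,
i.e. the Stone dual of the power set of `X`), as a compact ordered space with discrete order. -/
def betaObj (X : Type v) : KOrd.{v} :=
  letI := ultrafilterOrder X
  haveI : OrderClosedTopology (Ultrafilter X) := ⟨isClosed_diagonal⟩
  KOrd.of (Ultrafilter X)

theorem continuous_ultrafilter_map {X Y : Type v} (f : X → Y) :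
    Continuous (Ultrafilter.map f) :=
  ultrafilterBasis_is_basis.continuous_iff.2 (by
    rintro _ ⟨s, rfl⟩
    exact ultrafilter_isOpen_basic (f ⁻¹' s))

/-- The Stone-Čech compactification functor from sets to compact ordered spaces. -/
def beta : Type v ⥤ KOrd.{v} where
  obj X := betaObj X
  map {X Y} f :=
    { hom' :=
        { toFun := fun a => Ultrafilter.map (f : X → Y) a
          monotone' := fun _ _ h => congrArg (Ultrafilter.map (f : X → Y)) h
          continuous_toFun := continuous_ultrafilter_map (f : X → Y) } }
  map_id X := by
    apply KOrd.Hom.ext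
    ext a
    exact Ultrafilter.map_id a
  map_comp {X Y Z} f g := by
    apply KOrd.Hom.ext
    ext a
    exact (Ultrafilter.map_map a (m := (f : X → Y)) (n := (g : Y → Z))).symm

/-- The principal ultrafilter of a point, i.e. the embedding of `X` into `beta X`. -/
def betaUnit {X : Type v} (x : X) : beta.obj X := (pure x : Ultrafilter X)

/-- An `S`-structure on an ind-object `X` is a natural transformation `β ∘ X → S` whose naturality
squares have the interpolation property. It is determined by its restriction `X → S`, so that a
model of `S` is a type of `S` that is the restriction of an `S`-structure. -/
def isModel (S : PolyadicSpace C) : ObjectProperty (SType S) := fun X =>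
  ∃ φ : X.ind ⋙ beta ⟶ S.functor, NatInterpolation φ ∧
    ∀ (n : Cᵒᵖ) (p : X.ind.obj n), φ.app n (betaUnit p) = X.eval n p

/-- The category of models, a full subcategory of the category of types. It is the category of
models in the usual sense when `S` is open. -/
abbrev Mod (S : PolyadicSpace C) := (isModel S).FullSubcategory

theorem isModel_push {S P : PolyadicSpace C} (f : S ⟶ P) (X : SType S)
    (hX : isModel S X) : isModel P ((SType.push f).obj X) := by
  obtain ⟨φ, hφ, hp⟩ := hX
  exact ⟨φ ≫ f.nat, PolyadicSpace.natInterpolation_comp hφ f.interpolation,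
    fun n p => congrArg (f.nat.app n) (hp n p)⟩

/-- The functor between the categories of models induced by a morphism `S ⟶ P`. -/
def modMap {S P : PolyadicSpace C} (f : S ⟶ P) : Mod S ⥤ Mod P :=
  (isModel P).lift ((isModel S).ι ⋙ SType.push f)
    (fun X => isModel_push f X.obj X.property)

/-! ### Pointwise properties of a morphism -/

/-- Every component is surjective. -/
def PointwiseSurjective {S P : PolyadicSpace C} (f : S ⟶ P) : Prop :=
  ∀ n : Cᵒᵖ, Function.Surjective (f.nat.app n)

/-- Every component is an embedding of compact ordered spaces, i.e. a topological embedding that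
preserves and reflects the order. -/
def PointwiseEmbedding {S P : PolyadicSpace C} (f : S ⟶ P) : Prop :=
  ∀ n : Cᵒᵖ, Topology.IsEmbedding (f.nat.app n) ∧
    ∀ x y : S.functor.obj n, f.nat.app n x ≤ f.nat.app n y ↔ x ≤ y

end Polyadic

/-! The pivot is `exists_omegaSaturated`: every type maps to an `ω`-saturated model without changing
its values, so every element of `S(n)` is realised in one. Over open spaces these are also models
(`isModel_of_omegaSaturated`), so one argument serves both categories.

Surjectivity: realise `t` in `Y ≅ f^* X`; isomorphisms preserve values, so `t` is the `f`-image of a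
value of `X`.

Embedding: given `f x ≤ f y`, realise `x` at `p` in an `ω`-saturated `X`. Interpolation for `f` and
compactness give another valuation `z` of the same ind-object with `z p = y` and `f ∘ X ≤ f ∘ z`.
Extend `z` to an `ω`-saturated `Y`. The underlying map is a morphism `f^* X ⟶ f^* Y`; fullness makes
it a morphism `X ⟶ Y`, whence `x ≤ y`.

Faithfulness holds because `f^*` keeps underlying maps. For an equivalence, the components are
homeomorphisms and order isomorphisms, and their inverses assemble into an inverse morphism. -/

namespace Polyadic

/-! ### Transfinite iteration of one-step extensions -/

section Transfinite

open Limits SmallObject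

/-- If the objects satisfying `W` are closed under filtered colimits, each of a small family of
conditions `Sol r` is inherited along morphisms, and each single condition can be achieved by
mapping to another object of `W`, then all conditions can be achieved simultaneously. -/
theorem exists_hom_forall_of_step {D : Type*} [Category* D] [HasColimitsOfSize.{v, v} D]
    (W : ObjectProperty D)
    (hW : ∀ (J : Type v) [SmallCategory J] [IsFiltered J], W.IsClosedUnderColimitsOfShape J)
    [W.IsClosedUnderIsomorphisms] {R : Type v} (Sol : R → D → Prop)
    (mono : ∀ r {Z Z' : D}, (Z ⟶ Z') → Sol r Z → Sol r Z')
    (step : ∀ r (Z : D), W Z → ∃ (Z' : D) (_ : Z ⟶ Z'), W Z' ∧ Sol r Z')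
    (Z₀ : D) (hZ₀ : W Z₀) :
    ∃ (Z : D) (_ : Z₀ ⟶ Z), W Z ∧ ∀ r, Sol r Z := by
  classical
  rcases isEmpty_or_nonempty R with hR | hR
  · exact ⟨Z₀, 𝟙 _, hZ₀, fun r => hR.elim r⟩
  -- An infinite cardinal has no greatest ordinal below it, so every stage has a strict successor.
  let c : Cardinal.{v} := max (Cardinal.mk R) Cardinal.aleph0
  let J : Type v := c.ord.ToType
  have : NoMaxOrder J := Cardinal.noMaxOrder (le_max_right _ _)
  have hJ : Cardinal.mk J = c := Cardinal.mk_ord_toType c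
  have : Nonempty J := by
    rw [← Cardinal.mk_ne_zero_iff, hJ]
    exact (Cardinal.aleph0_pos.trans_le (le_max_right _ _)).ne'
  let _ : OrderBot J := WellFoundedLT.toOrderBot J
  let _ : SuccOrder J := SuccOrder.ofLinearWellFoundedLT J
  obtain ⟨e⟩ : Nonempty (R ↪ J) := by
    rw [← Cardinal.le_def, hJ]
    exact le_max_left _ _
  let g : J → R := Function.invFun e
  have hg : Function.Surjective g := Function.invFun_surjective e.injective
  -- The successor operation may depend only on the object, not on the stage, so it treats the least
  -- condition that is still unsolved.
  have step' : ∀ Z : D, ∃ (Z' : D) (_ : Z ⟶ Z'), (W Z → W Z') ∧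
      (W Z → ∀ j : J, (∀ i < j, Sol (g i) Z) → Sol (g j) Z') := by
    intro Z
    by_cases h : W Z ∧ ∃ j : J, ¬ Sol (g j) Z
    · obtain ⟨hZ, hj⟩ := h
      obtain ⟨j, hj, hmin⟩ := WellFounded.has_min (wellFounded_lt (α := J))
        {j | ¬ Sol (g j) Z} hj
      obtain ⟨Z', a, hZ', hs⟩ := step (g j) Z hZ
      refine ⟨Z', a, fun _ => hZ', fun _ k hk => ?_⟩
      rcases lt_trichotomy k j with h | rfl | h
      · exact mono _ a (not_not.1 fun h' => hmin k h' h)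
      · exact hs
      · exact (hj (hk j h)).elim
    · refine ⟨Z, 𝟙 _, id, fun hZ j _ => ?_⟩
      by_contra h'
      exact h ⟨hZ, j, h'⟩
  choose F a hF hS using step'
  let Φ : SuccStruct D := { X₀ := Z₀, succ := F, toSucc := a }
  let G := Φ.iterationFunctor J
  have key : ∀ j : J, W (G.obj j) ∧ ∀ i < j, Sol (g i) (G.obj j) := by
    intro j
    induction j using SuccOrder.limitRecOn with
    | isMin j hj =>
      obtain rfl := hj.eq_bot
      exact ⟨W.prop_of_iso (Φ.iterationFunctorObjBotIso J).symm hZ₀,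
        fun i hi => (not_lt_bot hi).elim⟩
    | succ j hj ih =>
      have e := (Φ.iterationFunctorObjSuccIso j hj).symm
      refine ⟨W.prop_of_iso e (hF _ ih.1), fun i hi => ?_⟩
      have hij := (Order.lt_succ_iff_of_not_isMax hj).1 hi
      refine mono _ e.hom (hS _ ih.1 i fun k hk => ih.2 k (hk.trans_le hij))
    | isSuccLimit j hj ih =>
      refine ⟨?_, fun i hi => mono _ (G.map (homOfLE (Order.succ_le_of_lt hi)))
        ((ih _ (hj.succ_lt hi)).2 i (Order.lt_succ i))⟩
      have : Nonempty (Set.Iio j) := ⟨⟨⊥, hj.bot_lt⟩⟩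
      have := hW (Set.Iio j)
      exact W.prop_of_isColimit (G.isColimitOfIsWellOrderContinuous j hj) fun i => (ih i.1 i.2).1
  refine ⟨Φ.iteration J, Φ.ιIteration J, ?_, fun r => ?_⟩
  · have := hW J
    exact W.prop_of_isColimit (Φ.isColimitIterationCocone J) fun j => (key j).1
  · obtain ⟨j, rfl⟩ := hg r
    exact mono _ (colimit.ι (Φ.iterationFunctor J) (Order.succ j)) ((key _).2 j (Order.lt_succ j))

end Transfinite

variable {C : Type u} [Category.{v} C]

/-! ### Compactness and presentations of ind-objects -/

section Sections

open Limits

theorem KOrd.map_comp_apply (S : Cᵒᵖ ⥤ KOrd.{v}) {a b c : C} (f : a ⟶ b) (g : b ⟶ c)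
    (x : S.obj (op c)) : S.map (f ≫ g).op x = S.map f.op (S.map g.op x) := by
  rw [op_comp, S.map_comp]
  rfl

theorem KOrd.map_id_apply (S : Cᵒᵖ ⥤ KOrd.{v}) {a : C} (x : S.obj (op a)) :
    S.map (𝟙 a).op x = x := by
  rw [op_id, S.map_id]
  rfl

theorem KOrd.continuous_map (S : Cᵒᵖ ⥤ KOrd.{v}) {a b : C} (f : a ⟶ b) :
    Continuous (S.map f.op) := (S.map f.op).hom'.continuous_toFun

theorem KOrd.monotone_map (S : Cᵒᵖ ⥤ KOrd.{v}) {a b : C} (f : a ⟶ b) :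
    Monotone (S.map f.op) := (S.map f.op).hom'.monotone'

/-- A cofiltered system of nonempty closed sets of values on a filtered diagram of representables
can be realised by a natural transformation from the colimit. -/
theorem exists_hom_of_isColimit (S : Cᵒᵖ ⥤ KOrd.{v}) {J : Type v} [SmallCategory J] [IsFiltered J]
    (D : J ⥤ C) (c : Cocone (D ⋙ yoneda)) (hc : IsColimit c)
    (K : ∀ j, Set (S.obj (op (D.obj j)))) (closed : ∀ j, IsClosed (K j))
    (nonempty : ∀ j, (K j).Nonempty)
    (stable : ∀ {i j} (f : i ⟶ j), ∀ a ∈ K j, S.map (D.map f).op a ∈ K i) :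
    ∃ x : c.pt ⟶ S ⋙ forget KOrd.{v}, ∀ j, yonedaEquiv (c.ι.app j ≫ x) ∈ K j := by
  -- A valuation of the colimit is a compatible family of values, so it is enough that this
  -- cofiltered system of nonempty compact Hausdorff spaces has nonempty limit.
  let F : Jᵒᵖ ⥤ TopCat.{v} :=
    { obj := fun j => TopCat.of (K j.unop)
      map := fun f => TopCat.ofHom
        ⟨fun a => ⟨S.map (D.map f.unop).op a.1, stable _ _ a.2⟩,
          Continuous.subtype_mk ((KOrd.continuous_map S _).comp continuous_subtype_val) _⟩
      map_id := fun j => by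
        ext a
        change S.map (D.map (𝟙 _)).op a.1 = a.1
        rw [D.map_id, KOrd.map_id_apply]
      map_comp := fun f g => by
        ext a
        change S.map (D.map (g.unop ≫ f.unop)).op a.1 = S.map (D.map g.unop).op
          (S.map (D.map f.unop).op a.1)
        rw [D.map_comp, KOrd.map_comp_apply] }
  have h1 (j) : Nonempty (F.obj j) := (nonempty j.unop).to_subtype
  have h2 (j) : CompactSpace (F.obj j) := isCompact_iff_compactSpace.1 (closed j.unop).isCompact
  have h3 (j) : T2Space (F.obj j) := inferInstanceAs (T2Space (K j.unop))
  obtain ⟨⟨w, hw⟩⟩ := TopCat.nonempty_limitCone_of_compact_t2_cofiltered_system F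
  have hw' {i j : J} (f : i ⟶ j) : S.map (D.map f).op (w (op j)).1 = (w (op i)).1 :=
    congrArg Subtype.val (hw f.op)
  let t : Cocone (D ⋙ yoneda) :=
    { pt := S ⋙ forget KOrd.{v}
      ι := { app := fun j => (yonedaEquiv (F := S ⋙ forget KOrd.{v})).symm (w (op j)).1
             naturality := fun i j f => by
              apply yonedaEquiv.injective
              have := yonedaEquiv_naturality (F := S ⋙ forget KOrd.{v})
                ((yonedaEquiv (F := S ⋙ forget KOrd.{v})).symm (w (op j)).1) (D.map f)
              refine this.symm.trans ?_
              erw [Equiv.apply_symm_apply, Category.comp_id, Equiv.apply_symm_apply]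
              exact hw' f } }
  refine ⟨hc.desc t, fun j => ?_⟩
  rw [hc.fac]
  change yonedaEquiv (F := S ⋙ forget KOrd.{v}) ((yonedaEquiv (F := S ⋙ forget KOrd.{v})).symm (w (op j)).1) ∈ K j
  rw [Equiv.apply_symm_apply]
  exact (w (op j)).2


/-- The point appears at some index `j₀`. Since `Under j₀` is final in a filtered category,
restricting to it changes nothing and makes the point visible at every index, compatibly. -/
theorem exists_presentation_under {A : Cᵒᵖ ⥤ Type v} (hA : IsIndObject A) {n : C}
    (p : A.obj (op n)) :
    ∃ (P : IndObjectPresentation A) (e : (Functor.const P.I).obj n ⟶ P.F),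
      ∀ j, (P.ι.app j).app (op n) (e.app j) = p := by
  obtain ⟨⟨P⟩⟩ := hA
  obtain ⟨j₀, p₀, hp₀⟩ := Types.jointly_surjective _
    (isColimitOfPreserves ((evaluation _ _).obj (op n)) P.isColimit) p
  let Q : IndObjectPresentation A :=
    { I := Under j₀
      F := Under.forget j₀ ⋙ P.F
      ι := Functor.whiskerLeft (Under.forget j₀) P.ι
      isColimit := (Functor.Final.isColimitWhiskerEquiv (Under.forget j₀) _).symm P.isColimit }
  let e : (Functor.const Q.I).obj n ⟶ Q.F :=
    { app := fun j => p₀ ≫ P.F.map j.hom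
      naturality := fun i j f => by
        change 𝟙 n ≫ p₀ ≫ P.F.map j.hom = (p₀ ≫ P.F.map i.hom) ≫ P.F.map f.right
        rw [Category.id_comp, Category.assoc, ← P.F.map_comp, Under.w f] }
  refine ⟨Q, e, fun j => ?_⟩
  have := congr_arg (fun x => x.app (op n) p₀) (P.ι.naturality j.hom)
  exact this.trans hp₀

/-- Boundedness, applied to a principal up-set, upgrades the inequality to an equality; thus
interpolants can be chosen with prescribed values. -/
theorem exists_le_map_eq (S : PolyadicSpace C) {n m : C} (σ : n ⟶ m) (a : S.functor.obj (op m))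
    (c : S.functor.obj (op n)) (h : S.functor.map σ.op a ≤ c) :
    ∃ a', a ≤ a' ∧ S.functor.map σ.op a' = c :=
  S.bounded σ (Set.Ici a) (isUpperSet_Ici a) h ⟨a, le_refl a, rfl⟩

theorem exists_map_eq_of_isPushout (S : PolyadicSpace C) {a b c d : C} {f : a ⟶ b} {g : a ⟶ c}
    {i : b ⟶ d} {j : c ⟶ d} (h : IsPushout f g i j) (s : S.functor.obj (op b))
    (t : S.functor.obj (op c)) (hst : S.functor.map f.op s ≤ S.functor.map g.op t) :
    ∃ r : S.functor.obj (op d), s ≤ S.functor.map i.op r ∧ S.functor.map j.op r = t := by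
  obtain ⟨r, hr, hr'⟩ := S.interpolation f g i j h s t hst
  obtain ⟨r', hrr', rfl⟩ := exists_le_map_eq S j r t hr'
  exact ⟨r', hr.trans (KOrd.monotone_map _ i hrr'), rfl⟩

end Sections

/-! ### One-step extensions and changes of valuation -/

section Extensions

open Limits

/-- The presheaf of sets underlying a presheaf of compact ordered spaces. -/
abbrev points (S : Cᵒᵖ ⥤ KOrd.{v}) : Cᵒᵖ ⥤ Type v := S ⋙ forget KOrd.{v}

/-- The action of a natural transformation to a presheaf of compact ordered spaces. -/
def valueAt {S : Cᵒᵖ ⥤ KOrd.{v}} {A : Cᵒᵖ ⥤ Type v} (x : A ⟶ points S) {n : C}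
    (p : A.obj (op n)) : S.obj (op n) := x.app (op n) p

theorem valueAt_map {S : Cᵒᵖ ⥤ KOrd.{v}} {A : Cᵒᵖ ⥤ Type v} (x : A ⟶ points S) {n m : C}
    (σ : n ⟶ m) (p : A.obj (op m)) :
    valueAt x (A.map σ.op p) = S.map σ.op (valueAt x p) :=
  ConcreteCategory.congr_hom (x.naturality σ.op) p

theorem app_eq_map_yonedaEquiv {A : Cᵒᵖ ⥤ Type v} {k n : C} (α : yoneda.obj k ⟶ A) (g : n ⟶ k) :
    α.app (op n) g = A.map g.op (yonedaEquiv α) := by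
  rw [yonedaEquiv_naturality]
  change _ = α.app (op n) (𝟙 n ≫ g)
  rw [Category.id_comp]

theorem exists_valueAt_mem (S : Cᵒᵖ ⥤ KOrd.{v}) {A : Cᵒᵖ ⥤ Type v}
    (P : IndObjectPresentation A) (K : ∀ j, Set (S.obj (op (P.F.obj j))))
    (closed : ∀ j, IsClosed (K j)) (nonempty : ∀ j, (K j).Nonempty)
    (stable : ∀ {i j} (f : i ⟶ j), ∀ a ∈ K j, S.map (P.F.map f).op a ∈ K i) :
    ∃ x : A ⟶ points S, ∀ j, valueAt x (yonedaEquiv (P.ι.app j)) ∈ K j :=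
  exists_hom_of_isColimit S P.F P.cocone P.isColimit K closed nonempty stable

theorem map_yonedaEquiv_ι {A : Cᵒᵖ ⥤ Type v} (P : IndObjectPresentation A) {i j : P.I}
    (f : i ⟶ j) :
    A.map (P.F.map f).op (yonedaEquiv (P.ι.app j)) = yonedaEquiv (P.ι.app i) := by
  rw [yonedaEquiv_naturality]
  exact congrArg yonedaEquiv ((P.ι.naturality f).trans (Category.comp_id _))

theorem exists_eq_map_yonedaEquiv_ι {A : Cᵒᵖ ⥤ Type v} (P : IndObjectPresentation A) {n : C}
    (p : A.obj (op n)) :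
    ∃ (j : P.I) (g : n ⟶ P.F.obj j), p = A.map g.op (yonedaEquiv (P.ι.app j)) := by
  obtain ⟨j, g, hg⟩ := Types.jointly_surjective _
    (isColimitOfPreserves ((evaluation _ _).obj (op n)) P.isColimit) p
  exact ⟨j, g, hg.symm.trans (app_eq_map_yonedaEquiv (P.ι.app j) g)⟩

/-- The new point is adjoined freely, by pushing a presentation of `Z.left` out along `σ` at each
index. Interpolation for these pushouts gives admissible values at each index, and compactness a
coherent choice. -/
theorem exists_extension [HasPushouts C] (S : PolyadicSpace C) (Z : Over (points S.functor))
    (hZ : IsIndObject Z.left) {n m : C} (σ : n ⟶ m) (p : Z.left.obj (op n))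
    (s : S.functor.obj (op m)) (hs : S.functor.map σ.op s ≤ valueAt Z.hom p) :
    ∃ (Z' : Over (points S.functor)) (h : Z ⟶ Z'), IsIndObject Z'.left ∧
      ∃ q : Z'.left.obj (op m), Z'.left.map σ.op q = h.left.app (op n) p ∧
        s ≤ valueAt Z'.hom q := by
  obtain ⟨P, e, he⟩ := exists_presentation_under hZ p
  let G : P.I ⥤ C := pushout ((Functor.const P.I).map σ) e
  let inl : (Functor.const P.I).obj m ⟶ G := pushout.inl _ _
  let inr : P.F ⟶ G := pushout.inr _ _
  have hpo (j : P.I) : IsPushout σ (e.app j) (inl.app j) (inr.app j) :=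
    (IsPushout.of_hasPushout ((Functor.const P.I).map σ) e).map ((evaluation _ _).obj j)
  have hinl {i j : P.I} (f : i ⟶ j) : inl.app i ≫ G.map f = inl.app j :=
    (inl.naturality f).symm.trans (Category.id_comp _)
  let Q : IndObjectPresentation (colimit (G ⋙ yoneda)) :=
    { I := P.I
      F := G
      ι := (colimit.cocone (G ⋙ yoneda)).ι
      isColimit := colimit.isColimit _ }
  let a : Z.left ⟶ colimit (G ⋙ yoneda) :=
    P.isColimit.desc ⟨_, Functor.whiskerRight inr yoneda ≫ Q.ι⟩
  have ha (j : P.I) : a.app _ (yonedaEquiv (P.ι.app j)) =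
      (colimit (G ⋙ yoneda)).map (inr.app j).op (yonedaEquiv (Q.ι.app j)) := by
    rw [yonedaEquiv_naturality]
    exact congrArg yonedaEquiv (P.isColimit.fac ⟨_, Functor.whiskerRight inr yoneda ≫ Q.ι⟩ j)
  have hp (j : P.I) : p = Z.left.map (e.app j).op (yonedaEquiv (P.ι.app j)) :=
    (he j).symm.trans (app_eq_map_yonedaEquiv (P.ι.app j) (e.app j))
  -- Admissible values are at least `s` on the new point and agree exactly with the old valuation.
  obtain ⟨x, hx⟩ := exists_valueAt_mem S.functor Q
    (fun j => {r | s ≤ S.functor.map (inl.app j).op r ∧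
      S.functor.map (inr.app j).op r = valueAt Z.hom (yonedaEquiv (P.ι.app j))})
    (fun j => (isClosed_le continuous_const (KOrd.continuous_map _ _)).inter
      (isClosed_eq (KOrd.continuous_map _ _) continuous_const))
    (fun j => exists_map_eq_of_isPushout S (hpo j) _ _ (by
      rwa [← valueAt_map, ← hp j]))
    (fun {i j} f r hr => by
      refine ⟨?_, ?_⟩
      · rw [← KOrd.map_comp_apply, hinl]
        exact hr.1
      · rw [← KOrd.map_comp_apply, ← inr.naturality, KOrd.map_comp_apply, hr.2, ← valueAt_map,
          map_yonedaEquiv_ι])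
  have hax : a ≫ x = Z.hom := by
    ext ⟨k⟩ r
    obtain ⟨j, g, rfl⟩ := exists_eq_map_yonedaEquiv_ι P r
    have h1 : valueAt (a ≫ x) (yonedaEquiv (P.ι.app j)) =
        valueAt Z.hom (yonedaEquiv (P.ι.app j)) := by
      refine (congrArg (valueAt x) (ha j)).trans ?_
      rw [valueAt_map]
      exact (hx j).2
    have h2 := congrArg (S.functor.map g.op) h1
    rw [← valueAt_map, ← valueAt_map] at h2
    exact h2
  let j : P.I := IsFiltered.nonempty.some
  refine ⟨Over.mk x, Over.homMk a hax, .mk Q,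
    (colimit (G ⋙ yoneda)).map (inl.app j).op (yonedaEquiv (Q.ι.app j)), ?_, ?_⟩
  · change (colimit (G ⋙ yoneda)).map σ.op _ = a.app (op n) p
    rw [hp j, ← Functor.map_comp_apply, ← op_comp, (hpo j).w, op_comp,
      Functor.map_comp_apply, ← ha j]
    exact (ConcreteCategory.congr_hom (a.naturality (e.app j).op) _).symm
  · change s ≤ valueAt x _
    rw [valueAt_map]
    exact (hx j).1

/-- Interpolation for `f`, sharpened by boundedness, gives admissible values at each index;
compactness makes them coherent. The comparison with `x` holds only after applying `f`. -/
theorem exists_valueAt_eq_of_le {S P : PolyadicSpace C} (f : S ⟶ P) {A : Cᵒᵖ ⥤ Type v}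
    (hA : IsIndObject A) (x : A ⟶ points S.functor) {n : C} (p : A.obj (op n))
    (s : S.functor.obj (op n))
    (h : f.nat.app (op n) (valueAt x p) ≤ f.nat.app (op n) s) :
    ∃ y : A ⟶ points S.functor, valueAt y p = s ∧ ∀ (m : C) (q : A.obj (op m)),
      f.nat.app (op m) (valueAt x q) ≤ f.nat.app (op m) (valueAt y q) := by
  have nat {k l : C} (g : k ⟶ l) (t : S.functor.obj (op l)) :
      f.nat.app (op k) (S.functor.map g.op t) = P.functor.map g.op (f.nat.app (op l) t) :=
    ConcreteCategory.congr_hom (f.nat.naturality g.op) t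
  obtain ⟨Q, e, he⟩ := exists_presentation_under hA p
  have hp (j : Q.I) : p = A.map (e.app j).op (yonedaEquiv (Q.ι.app j)) :=
    (he j).symm.trans (app_eq_map_yonedaEquiv (Q.ι.app j) (e.app j))
  have he' {i j : Q.I} (g : i ⟶ j) : e.app i ≫ Q.F.map g = e.app j :=
    (e.naturality g).symm.trans (Category.id_comp _)
  obtain ⟨y, hy⟩ := exists_valueAt_mem S.functor Q
    (fun j => {r | f.nat.app _ (valueAt x (yonedaEquiv (Q.ι.app j))) ≤ f.nat.app _ r ∧
      S.functor.map (e.app j).op r = s})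
    (fun j => (isClosed_le continuous_const (f.nat.app _).hom'.continuous_toFun).inter
      (isClosed_eq (KOrd.continuous_map _ _) continuous_const))
    (fun j => by
      obtain ⟨r, hr, hr'⟩ := f.interpolation (e.app j)
        (f.nat.app _ (valueAt x (yonedaEquiv (Q.ι.app j)))) s
        (by rwa [← nat, ← valueAt_map, ← hp j])
      obtain ⟨r', hrr', hr''⟩ := exists_le_map_eq S _ r s hr'
      exact ⟨r', hr.trans ((f.nat.app _).hom'.monotone' hrr'), hr''⟩)
    (fun {i j} g r hr => by
      refine ⟨?_, ?_⟩
      · rw [nat, ← map_yonedaEquiv_ι Q g, valueAt_map, nat]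
        exact KOrd.monotone_map _ _ hr.1
      · rw [← KOrd.map_comp_apply, he']
        exact hr.2)
  refine ⟨y, ?_, fun m q => ?_⟩
  · let j : Q.I := IsFiltered.nonempty.some
    rw [hp j, valueAt_map]
    exact (hy j).2
  · obtain ⟨j, g, rfl⟩ := exists_eq_map_yonedaEquiv_ι Q q
    rw [valueAt_map, valueAt_map, nat, nat]
    exact KOrd.monotone_map _ _ (hy j).1

end Extensions

/-! ### Construction of `ω`-saturated models -/

section Saturation

open Limits

theorem valueAt_app {S : Cᵒᵖ ⥤ KOrd.{v}} {Z Z' : Over (points S)} (h : Z ⟶ Z') {n : C}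
    (p : Z.left.obj (op n)) : valueAt Z'.hom (h.left.app (op n) p) = valueAt Z.hom p :=
  congrArg (fun x => valueAt x p) (Over.w h)

theorem isIndObject_isClosedUnderColimitsOfShape {D : Type*} [Category* D]
    (F : D ⥤ Cᵒᵖ ⥤ Type v) (J : Type v) [SmallCategory J] [IsFiltered J]
    [PreservesColimitsOfShape J F] :
    (ObjectProperty.inverseImage (IsIndObject (C := C)) F).IsClosedUnderColimitsOfShape J :=
  inferInstance

/-- `h : Z ⟶ Z'` solves all extension problems with parameters in `Z`. -/
def SolvesExtensions {S : Cᵒᵖ ⥤ KOrd.{v}} {Z Z' : Over (points S)} (h : Z ⟶ Z') : Prop :=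
  ∀ ⦃n m : C⦄ (σ : n ⟶ m) (p : Z.left.obj (op n)) (s : S.obj (op m)),
    S.map σ.op s ≤ valueAt Z.hom p →
      ∃ q : Z'.left.obj (op m), Z'.left.map σ.op q = h.left.app (op n) p ∧ s ≤ valueAt Z'.hom q

/-- With `C'` a small model of `C`, this reduces the extension problems to a small family, as
transfinite iteration requires. -/
theorem solvesExtensions_of_equivalence {S : Cᵒᵖ ⥤ KOrd.{v}} {Z Z' : Over (points S)} (h : Z ⟶ Z')
    {C' : Type*} [Category* C'] (E : C ≌ C')
    (H : ∀ ⦃a b : C'⦄ (σ : E.inverse.obj a ⟶ E.inverse.obj b)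
      (p : Z.left.obj (op (E.inverse.obj a))) (s : S.obj (op (E.inverse.obj b))),
      S.map σ.op s ≤ valueAt Z.hom p →
        ∃ q : Z'.left.obj (op (E.inverse.obj b)),
          Z'.left.map σ.op q = h.left.app _ p ∧ s ≤ valueAt Z'.hom q) :
    SolvesExtensions h := by
  intro n m σ p s hs
  let α : n ≅ E.inverse.obj (E.functor.obj n) := E.unitIso.app n
  let β : m ≅ E.inverse.obj (E.functor.obj m) := E.unitIso.app m
  obtain ⟨q, hq, hq'⟩ := H (α.inv ≫ σ ≫ β.hom) (Z.left.map α.inv.op p) (S.map β.inv.op s) (by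
    rw [← KOrd.map_comp_apply, Category.assoc, Category.assoc, β.hom_inv_id, Category.comp_id,
      KOrd.map_comp_apply, valueAt_map]
    exact KOrd.monotone_map _ _ hs)
  refine ⟨Z'.left.map β.hom.op q, ?_, ?_⟩
  · have h1 := congrArg (Z'.left.map α.hom.op) hq
    rw [← Functor.map_comp_apply, ← op_comp, α.hom_inv_id_assoc, op_comp,
      Functor.map_comp_apply] at h1
    rw [h1]
    have h2 := ConcreteCategory.congr_hom (h.left.naturality α.hom.op) (Z.left.map α.inv.op p)
    refine h2.symm.trans (congrArg (h.left.app (op n)) ?_)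
    change Z.left.map α.hom.op (Z.left.map α.inv.op p) = p
    rw [← Functor.map_comp_apply, ← op_comp, α.hom_inv_id, op_id, Functor.map_id_apply]
  · rw [valueAt_map]
    have h1 := KOrd.monotone_map S β.hom hq'
    rwa [← KOrd.map_comp_apply, β.hom_inv_id, KOrd.map_id_apply] at h1

theorem exists_solvesExtensions [EssentiallySmall.{v} C] [HasPushouts C] (S : PolyadicSpace C)
    (X : Over (points S.functor)) (hX : IsIndObject X.left) :
    ∃ (Z : Over (points S.functor)) (h : X ⟶ Z), IsIndObject Z.left ∧ SolvesExtensions h := by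
  let E := equivSmallModel.{v} C
  let R : Type v := Σ (a b : SmallModel.{v} C) (_ : E.inverse.obj a ⟶ E.inverse.obj b),
    X.left.obj (op (E.inverse.obj a)) × S.functor.obj (op (E.inverse.obj b))
  -- Working under `X` keeps the parameters in `X`, so a solution persists along later morphisms.
  let Sol : R → Under X → Prop := fun ⟨a, b, σ, p, s⟩ Z =>
    S.functor.map σ.op s ≤ valueAt X.hom p →
      ∃ q : Z.right.left.obj (op (E.inverse.obj b)),
        Z.right.left.map σ.op q = Z.hom.left.app _ p ∧ s ≤ valueAt Z.right.hom q
  obtain ⟨Z, a, hZ, hsol⟩ := exists_hom_forall_of_step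
    (ObjectProperty.inverseImage (IsIndObject (C := C)) (Under.forget X ⋙ Over.forget _))
    (fun J _ _ => isIndObject_isClosedUnderColimitsOfShape _ J) Sol
    (by
      rintro ⟨a, b, σ, p, s⟩ Z Z' g h hs
      obtain ⟨q, hq, hq'⟩ := h hs
      refine ⟨g.right.left.app _ q, ?_, hq'.trans_eq (valueAt_app g.right q).symm⟩
      refine (ConcreteCategory.congr_hom (g.right.left.naturality σ.op) q).symm.trans ?_
      refine (congrArg (g.right.left.app _) hq).trans ?_
      exact congrArg (fun k => k.left.app _ p) (Under.w g))
    (by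
      rintro ⟨a, b, σ, p, s⟩ Z hZ
      by_cases hs : S.functor.map σ.op s ≤ valueAt X.hom p
      · obtain ⟨Z', g, hZ', q, hq, hq'⟩ := exists_extension S Z.right hZ σ (Z.hom.left.app _ p) s
          (hs.trans_eq (valueAt_app Z.hom p).symm)
        exact ⟨Under.mk (Z.hom ≫ g), Under.homMk g rfl, hZ', fun _ => ⟨q, hq, hq'⟩⟩
      · exact ⟨Z, 𝟙 _, hZ, fun h => (hs h).elim⟩)
    (Under.mk (𝟙 X)) hX
  exact ⟨Z.right, Z.hom, hZ, solvesExtensions_of_equivalence _ E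
    fun a b σ p s hs => hsol ⟨a, b, σ, p, s⟩ hs⟩

/-- Every type extends to an `ω`-saturated model with the same values. -/
theorem exists_omegaSaturated [EssentiallySmall.{v} C] [HasPushouts C] {S : PolyadicSpace C}
    (X : SType S) :
    ∃ (Y : SType S) (h : X.ind ⟶ Y.ind), omegaSaturated S Y ∧
      ∀ (n : Cᵒᵖ) (p : X.ind.obj n), Y.eval n (h.app n p) = X.eval n p := by
  choose F a hF ha using exists_solvesExtensions S
  -- A chain of length `ω` suffices: each problem has one parameter, which appears at a finite stage
  -- `k` and is dealt with at `k + 1`.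
  let G : ℕ → {Z : Over (points S.functor) // IsIndObject Z.left} := fun k =>
    Nat.rec ⟨Over.mk X.val, X.isInd⟩ (fun _ Z => ⟨F Z.1 Z.2, hF _ _⟩) k
  let g (k : ℕ) : (G k).1 ⟶ (G (k + 1)).1 := a _ _
  let D : AsSmall.{v} ℕ ⥤ Over (points S.functor) := AsSmall.down ⋙ Functor.ofSequence g
  let Y : Over (points S.functor) := colimit D
  let ι (k : ℕ) : (G k).1 ⟶ Y := colimit.ι D (AsSmall.up.obj k)
  have hι (k : ℕ) : g k ≫ ι (k + 1) = ι k := by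
    have := colimit.w D (AsSmall.up.map (homOfLE (Nat.le_succ k)))
    refine Eq.trans ?_ this
    refine congrArg (· ≫ ι (k + 1)) ?_
    exact (Functor.ofSequence_map_homOfLE_succ g k).symm
  have hY : IsIndObject Y.left := by
    have := isIndObject_isClosedUnderColimitsOfShape (Over.forget (points S.functor))
      (AsSmall.{v} ℕ)
    exact ObjectProperty.prop_of_isColimit
      (ObjectProperty.inverseImage (IsIndObject (C := C)) (Over.forget _)) (colimit.isColimit D)
      fun j => (G (AsSmall.down.obj j)).2
  refine ⟨⟨Y.left, hY, Y.hom⟩, (ι 0).left, fun n m σ s p hs => ?_,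
    fun n p => valueAt_app (ι 0) p⟩
  obtain ⟨j, p, rfl⟩ := Types.jointly_surjective _
    (isColimitOfPreserves (Over.forget _ ⋙ (evaluation _ _).obj (op n)) (colimit.isColimit D)) p
  obtain ⟨k, rfl⟩ : ∃ k, j = AsSmall.up.obj k := ⟨AsSmall.down.obj j, rfl⟩
  obtain ⟨q, hq, hq'⟩ := ha (G k).1 (G k).2 σ p s (hs.trans_eq (valueAt_app (ι k) p))
  refine ⟨(ι (k + 1)).left.app (op m) q, hq'.trans_eq (valueAt_app (ι (k + 1)) q).symm, ?_⟩
  refine (ConcreteCategory.congr_hom ((ι (k + 1)).left.naturality σ.op) q).symm.trans ?_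
  refine (congrArg ((ι (k + 1)).left.app _) hq).trans ?_
  exact congrArg (fun r => r.left.app (op n) p) (hι k)

end Saturation

/-! ### Saturated models over open spaces -/

section Models

open Filter Topology

theorem exists_isOpen_isUpperSet_notMem_closure {E : Type*} [TopologicalSpace E] [PartialOrder E]
    [CompactSpace E] [OrderClosedTopology E] {s t : E} (h : ¬ s ≤ t) :
    ∃ U : Set E, IsOpen U ∧ IsUpperSet U ∧ s ∈ U ∧ t ∉ closure U := by
  have hV : IsOpen {b : E | ¬ s ≤ b} := (isClosed_le continuous_const continuous_id).isOpen_compl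
  obtain ⟨N, hN, hNc, hNV⟩ := exists_mem_nhds_isClosed_subset (hV.mem_nhds h)
  -- The down-closure of a closed set is closed by compactness; its complement is the required
  -- up-set.
  have hL : IsClosed (Prod.fst '' {q : E × E | q.1 ≤ q.2 ∧ q.2 ∈ N}) :=
    (((isClosed_le continuous_fst continuous_snd).inter
      (hNc.preimage continuous_snd)).isCompact.image continuous_fst).isClosed
  refine ⟨_, hL.isOpen_compl, ?_, ?_, ?_⟩
  · rintro a b hab ha ⟨⟨b', c⟩, ⟨hbc, hc⟩, rfl⟩
    exact ha ⟨(a, c), ⟨hab.trans hbc, hc⟩, rfl⟩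
  · rintro ⟨⟨s', c⟩, ⟨hsc, hc⟩, rfl⟩
    exact hNV hc hsc
  · intro ht
    obtain ⟨b, hb, hb'⟩ := mem_closure_iff_nhds.1 ht N hN
    exact hb' ⟨(b, b), ⟨le_refl b, hb⟩, rfl⟩

theorem tendsto_extend {X E : Type*} [TopologicalSpace E] [CompactSpace E] [T2Space E]
    (x : X → E) (b : Ultrafilter X) : Tendsto x b (𝓝 (Ultrafilter.extend x b)) :=
  ultrafilter_extend_eq_iff.1 rfl

/-- The transformation `β ∘ X → S` extending a type `X → S`. -/
noncomputable def betaExtend {S : PolyadicSpace C} (X : SType S) : X.ind ⋙ beta ⟶ S.functor where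
  app n :=
    { hom' :=
        { toFun := fun (b : Ultrafilter (X.ind.obj n)) => Ultrafilter.extend (X.eval n) b
          monotone' := fun _ _ h => le_of_eq (congrArg (Ultrafilter.extend (X.eval n)) h)
          continuous_toFun := continuous_ultrafilter_extend _ } }
  naturality n m σ := by
    apply KOrd.Hom.ext
    ext (b : Ultrafilter (X.ind.obj n))
    have h1 := tendsto_extend (X.eval m) (b.map (X.ind.map σ))
    have h2 := ((S.functor.map σ).hom'.continuous_toFun.tendsto _).comp
      (tendsto_extend (X.eval n) b)
    rw [Ultrafilter.coe_map, tendsto_map'_iff] at h1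
    have h3 : X.eval m ∘ X.ind.map σ = S.functor.map σ ∘ X.eval n :=
      funext fun p => ConcreteCategory.congr_hom (X.val.naturality σ) p
    rw [h3] at h1
    exact tendsto_nhds_unique h1 h2

/-- Over an open polyadic space, `ω`-saturated models are models. -/
theorem isModel_of_omegaSaturated {S : PolyadicSpace C} (hS : S.IsOpenSpace) {X : SType S}
    (hX : omegaSaturated S X) : isModel S X := by
  refine ⟨betaExtend X, ?_, fun n p => ultrafilter_extend_pure _ _⟩
  intro n m σ s (a : Ultrafilter (X.ind.obj (op n))) hs
  have hs : S.functor.map σ.op s ≤ Ultrafilter.extend (X.eval (op n)) a := hs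
  -- An ultrafilter containing these sets maps onto `a`, and its limit lies above `s`.
  let B : FilterBasis (X.ind.obj (op m)) :=
    { sets := {V | ∃ U : Set (S.functor.obj (op m)), (IsOpen U ∧ IsUpperSet U ∧ s ∈ U) ∧
        ∃ A ∈ a, V = X.eval (op m) ⁻¹' U ∩ X.ind.map σ.op ⁻¹' A}
      nonempty := ⟨_, Set.univ, ⟨isOpen_univ, isUpperSet_univ, trivial⟩, Set.univ, univ_mem, rfl⟩
      inter_sets := by
        rintro _ _ ⟨U, ⟨h1, h2, h3⟩, A, hA, rfl⟩ ⟨U', ⟨h1', h2', h3'⟩, A', hA', rfl⟩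
        refine ⟨_, ⟨U ∩ U', ⟨h1.inter h1', h2.inter h2', h3, h3'⟩, A ∩ A', inter_mem hA hA', rfl⟩,
          ?_⟩
        rintro q ⟨⟨hq1, hq2⟩, hq3, hq4⟩
        exact ⟨⟨hq1, hq3⟩, hq2, hq4⟩ }
  have hB : B.filter.NeBot := by
    rw [B.hasBasis.neBot_iff]
    -- The image of `U` is an open up-set containing the limit of `a`, so some `p ∈ A` has its value
    -- there; saturation lifts `p`.
    rintro _ ⟨U, ⟨hU, hU', hsU⟩, A, hA, rfl⟩
    have hV := hS σ U hU hU'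
    have h1 : Ultrafilter.extend (X.eval (op n)) a ∈ S.functor.map σ.op '' U :=
      hV.2 hs ⟨s, hsU, rfl⟩
    have h2 := tendsto_extend (X.eval (op n)) a (hV.1.mem_nhds h1)
    obtain ⟨p, ⟨u, hu, hup⟩, hpA⟩ := a.nonempty_of_mem (inter_mem h2 hA)
    obtain ⟨q, hq, rfl⟩ := hX σ u p hup.le
    exact ⟨q, hU' hq hu, hpA⟩
  let b : Ultrafilter (X.ind.obj (op m)) := Ultrafilter.of B.filter
  have hb : (b : Filter _) ≤ B.filter := Ultrafilter.of_le _
  refine ⟨b, ?_, ?_⟩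
  · change s ≤ Ultrafilter.extend (X.eval (op m)) b
    by_contra h
    obtain ⟨U, hU, hU', hsU, ht⟩ := exists_isOpen_isUpperSet_notMem_closure h
    refine ht (mem_closure_of_tendsto (tendsto_extend (X.eval (op m)) b) ?_)
    refine mem_of_superset (hb (B.mem_filter_of_mem
      ⟨U, ⟨hU, hU', hsU⟩, Set.univ, univ_mem, rfl⟩)) Set.inter_subset_left
  · change b.map (X.ind.map σ.op) = a
    refine Ultrafilter.coe_le_coe.1 fun A hA => ?_
    have hAB : X.eval (op m) ⁻¹' Set.univ ∩ X.ind.map σ.op ⁻¹' A ∈ b := hb (B.mem_filter_of_mem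
      ⟨Set.univ, ⟨isOpen_univ, isUpperSet_univ, trivial⟩, A, hA, rfl⟩)
    change X.ind.map σ.op ⁻¹' A ∈ b
    exact Filter.mem_of_superset hAB Set.inter_subset_right

end Models

/-! ### From properties of the functor to properties of the morphism -/

section Functors

variable {S P : PolyadicSpace C}

/-- A morphism can only increase values; apply this to `e` and its inverse. -/
theorem SType.eval_eq_of_iso {X Y : SType S} (e : X ≅ Y) (n : Cᵒᵖ) (p : X.ind.obj n) :
    Y.eval n (e.hom.map.app n p) = X.eval n p := by
  refine le_antisymm ((e.inv.eval_le n _).trans_eq ?_) (e.hom.eval_le n p)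
  exact congrArg (fun k : X ⟶ X => X.eval n (k.map.app n p)) e.hom_inv_id

/-- The type given by an element of a polyadic space. -/
def SType.ofElement (S : PolyadicSpace C) {n : C} (s : S.functor.obj (op n)) : SType S where
  ind := yoneda.obj n
  isInd := Limits.isIndObject_yoneda n
  val := yonedaEquiv.symm s

theorem SType.eval_ofElement (S : PolyadicSpace C) {n : C} (s : S.functor.obj (op n)) :
    (SType.ofElement S s).eval (op n) (𝟙 n) = s :=
  (yonedaEquiv (F := points S.functor)).apply_symm_apply s

theorem exists_omegaSaturated_eval_eq [EssentiallySmall.{v} C] [Limits.HasPushouts C]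
    (S : PolyadicSpace C) {n : C} (s : S.functor.obj (op n)) :
    ∃ (X : SType S) (p : X.ind.obj (op n)), omegaSaturated S X ∧ X.eval (op n) p = s := by
  obtain ⟨X, h, hX, hh⟩ := exists_omegaSaturated (SType.ofElement S s)
  exact ⟨X, h.app _ (𝟙 n), hX, (hh _ _).trans (SType.eval_ofElement S s)⟩

theorem isEmbedding_of_le_iff {X Y : KOrd.{v}} (f : X ⟶ Y) (h : ∀ x y, f x ≤ f y ↔ x ≤ y) :
    Topology.IsEmbedding f := by
  have hf : Continuous f := f.hom'.continuous_toFun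
  exact (hf.isClosedEmbedding fun x y hxy =>
    le_antisymm ((h x y).1 hxy.le) ((h y x).1 hxy.ge)).isEmbedding

/-- The inverse of a morphism of polyadic spaces that is a pointwise surjective embedding. -/
theorem isIso_of_pointwise (f : S ⟶ P) (hs : PointwiseSurjective f) (he : PointwiseEmbedding f) :
    IsIso f := by
  let e (n : Cᵒᵖ) : S.functor.obj n ≃ₜ P.functor.obj n :=
    (he n).1.toHomeomorphOfSurjective (hs n)
  have hfe (n : Cᵒᵖ) (t : P.functor.obj n) : f.nat.app n ((e n).symm t) = t :=
    (e n).apply_symm_apply t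
  have hef (n : Cᵒᵖ) (s : S.functor.obj n) : (e n).symm (f.nat.app n s) = s :=
    (e n).symm_apply_apply s
  let g : P.functor ⟶ S.functor :=
    { app := fun n =>
        { hom' :=
            { toFun := (e n).symm
              monotone' := fun a b h => ((he n).2 _ _).1 (by rwa [hfe, hfe])
              continuous_toFun := (e n).symm.continuous } }
      naturality := fun n m σ => by
        apply KOrd.Hom.ext
        ext t
        change (e m).symm (P.functor.map σ t) = S.functor.map σ ((e n).symm t)
        apply (he m).1.injective
        rw [hfe]
        refine Eq.trans ?_ (ConcreteCategory.congr_hom (f.nat.naturality σ) _).symm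
        exact congrArg (P.functor.map σ) (hfe n t).symm }
  -- The image of `s` under `f` is an exact interpolant.
  refine ⟨⟨g, fun n m σ s t h => ⟨f.nat.app (op m) s, (hef _ s).ge, ?_⟩⟩, ?_, ?_⟩
  · rw [← hfe _ t]
    refine (ConcreteCategory.congr_hom (f.nat.naturality σ.op) s).symm.le.trans ?_
    exact (f.nat.app _).hom'.monotone' h
  · apply PolyadicSpace.Hom.ext
    ext n s
    exact hef n s
  · apply PolyadicSpace.Hom.ext
    ext n t
    exact hfe n t

theorem SType.push_map_injective (f : S ⟶ P) {X Y : SType S} {h k : X ⟶ Y}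
    (e : (SType.push f).map h = (SType.push f).map k) : h = k :=
  SType.Hom.ext (congrArg (fun l : (SType.push f).obj X ⟶ (SType.push f).obj Y =>
    SType.Hom.map l) e)

variable [EssentiallySmall.{v} C] [Limits.HasPushouts C]

theorem pointwiseSurjective_of_iso (f : S ⟶ P)
    (H : ∀ Y : SType P, omegaSaturated P Y → ∃ X : SType S, Nonempty ((SType.push f).obj X ≅ Y)) :
    PointwiseSurjective f := by
  intro n t
  obtain ⟨Y, q, hY, rfl⟩ := exists_omegaSaturated_eval_eq P (n := n.unop) t
  obtain ⟨X, ⟨e⟩⟩ := H Y hY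
  exact ⟨X.eval n (e.inv.map.app n q), SType.eval_eq_of_iso e.symm n q⟩

/-- Lifting is required only between `ω`-saturated types, so fullness on either category of models
supplies it. -/
theorem pointwiseEmbedding_of_lift (f : S ⟶ P)
    (H : ∀ X Y : SType S, omegaSaturated S X → omegaSaturated S Y →
      ∀ h : (SType.push f).obj X ⟶ (SType.push f).obj Y, ∃ k : X ⟶ Y, (SType.push f).map k = h) :
    PointwiseEmbedding f := by
  suffices h : ∀ (n : Cᵒᵖ) (x y : S.functor.obj n), f.nat.app n x ≤ f.nat.app n y ↔ x ≤ y from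
    fun n => ⟨isEmbedding_of_le_iff _ (h n), h n⟩
  intro n x y
  refine ⟨fun hxy => ?_, fun h => (f.nat.app n).hom'.monotone' h⟩
  obtain ⟨X, p, hX, rfl⟩ := exists_omegaSaturated_eval_eq S (n := n.unop) x
  obtain ⟨z, rfl, hz⟩ := exists_valueAt_eq_of_le f X.isInd X.val p y hxy
  obtain ⟨Y, h, hY, hh⟩ := exists_omegaSaturated ⟨X.ind, X.isInd, z⟩
  -- A priori `h` increases values only after applying `f`; lifting it gives the inequality in `S`.
  obtain ⟨k, hk⟩ := H X Y hX hY ⟨h, fun m q =>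
    (hz m.unop q).trans_eq (congrArg (f.nat.app m) (hh m q)).symm⟩
  have hkh : k.map = h := congrArg (fun l => SType.Hom.map l) hk
  have hle := k.eval_le n p
  rw [hkh] at hle
  exact hle.trans_eq (hh n p)

end Functors

end Polyadic

theorem mainTheorem10 {C : Type u} [Category.{v} C] [EssentiallySmall.{v} C]
    [Limits.HasPushouts C] (S P : Polyadic.PolyadicSpace C) (f : S ⟶ P) :
    -- categories of `ω`-saturated models, for arbitrary polyadic compact ordered spaces
    ((Polyadic.modOmegaMap f).Faithful ∧
      ((Polyadic.modOmegaMap f).EssSurj → Polyadic.PointwiseSurjective f) ∧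
      ((Polyadic.modOmegaMap f).Full ∧ (Polyadic.modOmegaMap f).Faithful →
        Polyadic.PointwiseEmbedding f) ∧
      ((Polyadic.modOmegaMap f).IsEquivalence → IsIso f)) ∧
    -- categories of models, for open polyadic compact ordered spaces
    (S.IsOpenSpace → P.IsOpenSpace →
      (Polyadic.modMap f).Faithful ∧
      ((Polyadic.modMap f).EssSurj → Polyadic.PointwiseSurjective f) ∧
      ((Polyadic.modMap f).Full ∧ (Polyadic.modMap f).Faithful →
        Polyadic.PointwiseEmbedding f) ∧
      ((Polyadic.modMap f).IsEquivalence → IsIso f)) := by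
  constructor
  · have surj : (Polyadic.modOmegaMap f).EssSurj → Polyadic.PointwiseSurjective f := fun h =>
      Polyadic.pointwiseSurjective_of_iso f fun Y hY => by
        obtain ⟨X, ⟨e⟩⟩ := h.mem_essImage ⟨Y, hY⟩
        exact ⟨X.obj, ⟨(Polyadic.omegaSaturated P).ι.mapIso e⟩⟩
    have emb : (Polyadic.modOmegaMap f).Full → Polyadic.PointwiseEmbedding f := fun h =>
      Polyadic.pointwiseEmbedding_of_lift f fun X Y hX hY a => by
        let X' : Polyadic.ModOmega S := ⟨X, hX⟩
        let Y' : Polyadic.ModOmega S := ⟨Y, hY⟩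
        let b : (Polyadic.modOmegaMap f).obj X' ⟶ (Polyadic.modOmegaMap f).obj Y' := ⟨a⟩
        obtain ⟨k, hk⟩ := (Polyadic.modOmegaMap f).map_surjective b
        exact ⟨k.hom, congrArg (fun l => l.hom) hk⟩
    refine ⟨⟨fun h => ?_⟩, surj, fun h => emb h.1, fun h =>
      Polyadic.isIso_of_pointwise f (surj h.essSurj) (emb h.full)⟩
    exact InducedCategory.Hom.ext
      (Polyadic.SType.push_map_injective f (congrArg (fun l => l.hom) h))
  · intro hS hP
    have surj : (Polyadic.modMap f).EssSurj → Polyadic.PointwiseSurjective f := fun h =>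
      Polyadic.pointwiseSurjective_of_iso f fun Y hY => by
        obtain ⟨X, ⟨e⟩⟩ := h.mem_essImage ⟨Y, Polyadic.isModel_of_omegaSaturated hP hY⟩
        exact ⟨X.obj, ⟨(Polyadic.isModel P).ι.mapIso e⟩⟩
    have emb : (Polyadic.modMap f).Full → Polyadic.PointwiseEmbedding f := fun h =>
      Polyadic.pointwiseEmbedding_of_lift f fun X Y hX hY a => by
        let X' : Polyadic.Mod S := ⟨X, Polyadic.isModel_of_omegaSaturated hS hX⟩
        let Y' : Polyadic.Mod S := ⟨Y, Polyadic.isModel_of_omegaSaturated hS hY⟩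
        let b : (Polyadic.modMap f).obj X' ⟶ (Polyadic.modMap f).obj Y' := ⟨a⟩
        obtain ⟨k, hk⟩ := (Polyadic.modMap f).map_surjective b
        exact ⟨k.hom, congrArg (fun l => l.hom) hk⟩
    refine ⟨⟨fun h => ?_⟩, surj, fun h => emb h.1, fun h =>
      Polyadic.isIso_of_pointwise f (surj h.essSurj) (emb h.full)⟩
    exact InducedCategory.Hom.ext
      (Polyadic.SType.push_map_injective f (congrArg (fun l => l.hom) h))
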